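/- Let $n\ge 0$ and let $X_1,\dots,X_n$ be independent random variables, uniformly distributed on $[0,1]$. The values are presented one at a time, and each $X_i$ must be irrevocably selected or rejected on the basis of $X_1,\dots,X_i$. A policy is feasible if the selected subsequence is always unimodal, i.e. first weakly increasing and then weakly decreasing (either piece may be trivial); a feasible policy is optimal if it maximizes the expected number of selected elements among all feasible policies. Let $S_i$ be the last value selected up to and including time $i$, with $S_0=0$, and let $R_i=0$ as long as the selections up to time $i$ are increasing and $R_i=1$ once a strict decrease has occurred, with $R_0=0$. A non-randomized Markov policy $\pi^*$ is given by sets $D_i(s,r)\subseteq[0,1]$, for $1\le i\le n$, $s\in[0,1]$, $r\in\{0,1\}$, with $\{(s,x): x\in D_i(s,r)\}$ Borel for all $i,r$ and with $D_i(s,1)\subseteq[0,s]$; it selects $X_i$ if and only if $X_i\in D_i(S_{i-1},R_{i-1})$. An interval policy is a Markov policy with acceptance sets $[a(i,s,r),b(i,s,r)]$, where $a(i,\cdot,r),b(i,\cdot,r):[0,1]\to[0,1]$ are Borel functions with $$0\le a(i,s,r)\le s,\qquad s\le b(i,s,0)\le 1,\qquad b(i,s,1)=s .$$ **Proposition.**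 If the non-randomized Markov policy $\pi^*$ with acceptance sets $D_i(s,r)$ is optimal, then, up to null sets, it is an interval policy. Precisely, there is an interval policy with endpoints $a,b$ such that: 1. for every $1\le i\le n$, almost surely, the sets $D_i(S_{i-1},R_{i-1})$ and $[a(i,S_{i-1},R_{i-1}),\,b(i,S_{i-1},R_{i-1})]$ differ by a Lebesgue null set, where $(S_{i-1},R_{i-1})$ is the state under $\pi^*$; 2. almost surely, $\pi^*$ and the interval policy select the same elements; 3. for all $1\le i\le n$, $s\in[0,1]$ and $r\in\{0,1\}$: if $\pi^*$ is also optimal for the remaining problem in which $X_i,\dots,X_n$ are still to come and $(S_{i-1},R_{i-1})=(s,r)$, then $D_i(s,r)$ and $[a(i,s,r),b(i,s,r)]$ differ by a Lebesgue null set. -/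

import Mathlib

open MeasureTheory ProbabilityTheory

/-!
Sequential selection of a unimodal subsequence from `X 1, …, X n`, observations with values in
`[0, 1]` (the type `unitInterval`).  The phase `r : Bool` is `false` as long as the selections are
increasing (`R = 0`) and `true` once a decrease has occurred (`R = 1`).
-/

namespace UnimodalSelection

/-- The values `x k`, `k ∈ T`, listed by increasing index, first weakly increase and then weakly
decrease; either piece may be trivial. -/
def UnimodalOn (x : ℕ → unitInterval) (T : Set ℕ) : Prop :=
  ∃ t : ℕ, MonotoneOn x (T ∩ Set.Iic t) ∧ AntitoneOn x (T ∩ Set.Ici t)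

section Policies

variable {Ω : Type*} [MeasurableSpace Ω]

/-- The σ-field `σ(X 1, …, X k)`. -/
@[reducible] def history (X : ℕ → Ω → unitInterval) (k : ℕ) : MeasurableSpace Ω :=
  ⨆ j ∈ Finset.Icc 1 k, MeasurableSpace.comap (X j) inferInstance

/-- The indices in `{m, …, n}` that are selected at `ω`, where `A k` is the event that the `k`-th
observation is selected. -/
def selectedIndices (A : ℕ → Set Ω) (m n : ℕ) (ω : Ω) : Set ℕ :=
  {k | k ∈ Finset.Icc m n ∧ ω ∈ A k}

/-- The expected number of selections made from the observations `m, …, n`. -/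
noncomputable def expectedLength (P : Measure Ω) (m n : ℕ) (A : ℕ → Set Ω) : ℝ :=
  ∫ ω, ((selectedIndices A m n ω).ncard : ℝ) ∂P

/-- Feasible (not necessarily Markov) selection policies for `X 1, …, X n`: the decision about
`X k` is made on the basis of `X 1, …, X k`, and the selected subsequence is unimodal. -/
structure IsFeasible (X : ℕ → Ω → unitInterval) (n : ℕ) (A : ℕ → Set Ω) : Prop where
  adapted : ∀ k ∈ Finset.Icc 1 n, MeasurableSet[history X k] (A k)
  unimodal : ∀ ω, UnimodalOn (fun k => X k ω) (selectedIndices A 1 n ω)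

/-- A feasible policy that maximizes the expected number of selections among all of them. -/
def IsOptimal (P : Measure Ω) (X : ℕ → Ω → unitInterval) (n : ℕ) (A : ℕ → Set Ω) : Prop :=
  IsFeasible X n A ∧
    ∀ B : ℕ → Set Ω, IsFeasible X n B → expectedLength P 1 n B ≤ expectedLength P 1 n A

/-- Feasible policies for the remaining problem, in which the observations `X m, …, X n` are still
to come, the last selected value is `s` and the phase is `r`.  The value `s` is put in front of the
newly selected values, at index `m - 1`; the result has to be unimodal if `r = false` and
decreasing if `r = true`. -/
structure IsFeasibleFrom (X : ℕ → Ω → unitInterval) (n m : ℕ) (s : unitInterval) (r : Bool)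
    (A : ℕ → Set Ω) : Prop where
  adapted : ∀ k ∈ Finset.Icc m n, MeasurableSet[history X k] (A k)
  unimodal : r = false → ∀ ω, UnimodalOn (Function.update (fun k => X k ω) (m - 1) s)
    (insert (m - 1) (selectedIndices A m n ω))
  antitone : r = true → ∀ ω, AntitoneOn (Function.update (fun k => X k ω) (m - 1) s)
    (insert (m - 1) (selectedIndices A m n ω))

/-- A policy that is optimal for the remaining problem. -/
def IsOptimalFrom (P : Measure Ω) (X : ℕ → Ω → unitInterval) (n m : ℕ) (s : unitInterval)
    (r : Bool) (A : ℕ → Set Ω) : Prop :=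
  IsFeasibleFrom X n m s r A ∧
    ∀ B : ℕ → Set Ω, IsFeasibleFrom X n m s r B →
      expectedLength P m n B ≤ expectedLength P m n A

end Policies

/-- A family of acceptance sets `D i s r ⊆ [0, 1]` (time `i`, last selected value `s`, phase `r`)
is a non-randomized Markov policy: the decision is a Borel function of `(s, r, x)`, and in the
decreasing phase only values that are at most `s` are accepted. -/
structure IsMarkovPolicy (n : ℕ) (D : ℕ → unitInterval → Bool → Set unitInterval) : Prop where
  measurable : ∀ i ∈ Finset.Icc 1 n, ∀ r : Bool,
    MeasurableSet {p : unitInterval × unitInterval | p.2 ∈ D i p.1 r}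
  admissible : ∀ i ∈ Finset.Icc 1 n, ∀ s : unitInterval, D i s true ⊆ Set.Iic s

/-- One transition of the pair (last selected value, phase) when `x` is presented and `D` gives the
acceptance sets. -/
noncomputable def step (D : unitInterval → Bool → Set unitInterval) (x : unitInterval)
    (p : unitInterval × Bool) : unitInterval × Bool :=
  open Classical in
  if x ∈ D p.1 p.2 then (x, p.2 || decide (x < p.1)) else p

/-- The pair `(S_k, R_k)` under the acceptance sets `D` along the observations `x`, started with
the pair `p` just before the `m`-th observation is presented. -/
noncomputable def stateFrom (D : ℕ → unitInterval → Bool → Set unitInterval) (x : ℕ → unitInterval)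
    (m : ℕ) (p : unitInterval × Bool) : ℕ → unitInterval × Bool
  | 0 => p
  | k + 1 => if k + 1 < m then p else step (D (k + 1)) (x (k + 1)) (stateFrom D x m p k)

/-- The event that the `k`-th observation is selected by the acceptance sets `D`, with the start
as in `stateFrom`. -/
def selectionEventFrom {Ω : Type*} (D : ℕ → unitInterval → Bool → Set unitInterval)
    (X : ℕ → Ω → unitInterval) (m : ℕ) (p : unitInterval × Bool) (k : ℕ) : Set Ω :=
  {ω | X k ω ∈ D k (stateFrom D (fun j => X j ω) m p (k - 1)).1
    (stateFrom D (fun j => X j ω) m p (k - 1)).2}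

/-- The pair `(S_k, R_k)` in the full problem, where `S_0 = 0` and `R_0 = 0`. -/
noncomputable def state (D : ℕ → unitInterval → Bool → Set unitInterval) (x : ℕ → unitInterval)
    (k : ℕ) : unitInterval × Bool :=
  stateFrom D x 1 (0, false) k

/-- The event that the `k`-th observation is selected in the full problem. -/
def selectionEvent {Ω : Type*} (D : ℕ → unitInterval → Bool → Set unitInterval)
    (X : ℕ → Ω → unitInterval) (k : ℕ) : Set Ω :=
  selectionEventFrom D X 1 (0, false) k

/-- The endpoints of a feasible interval policy. -/
structure IsIntervalPolicy (n : ℕ) (a b : ℕ → unitInterval → Bool → unitInterval) : Prop where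
  left_le : ∀ i ∈ Finset.Icc 1 n, ∀ s r, a i s r ≤ s
  le_right : ∀ i ∈ Finset.Icc 1 n, ∀ s, s ≤ b i s false
  right_eq : ∀ i ∈ Finset.Icc 1 n, ∀ s, b i s true = s
  measurable_left : ∀ i ∈ Finset.Icc 1 n, ∀ r, Measurable fun s => a i s r
  measurable_right : ∀ i ∈ Finset.Icc 1 n, ∀ r, Measurable fun s => b i s r

/-- The acceptance sets of the interval policy with endpoints `a` and `b`. -/
def intervalRule (a b : ℕ → unitInterval → Bool → unitInterval) :
    ℕ → unitInterval → Bool → Set unitInterval :=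
  fun i s r => Set.Icc (a i s r) (b i s r)

end UnimodalSelection

/-!
The problem is solved by dynamic programming, and the acceptance sets of an optimal policy are read
off from the optimality equation.

Let `value j (s, r)` be the optimal expected number of further selections when `j` observations are
still to come, the last selected value is `s` and the phase is `r`; it is defined by
`value (j + 1) p = ∫ x, bestReward (value j) p x`, where `bestReward` takes the better of selecting
and rejecting.  By induction on `j`, `value j` increases in `s` in the decreasing phase, decreases
in `s` in the increasing phase, and is never smaller in the increasing phase
(`isRegularValue_value`).  Hence the set `greedySet` of observations worth selecting is, up to its
endpoints, an interval around `s`, whose endpoints are a monotone function of `s`, cut off at `s`,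
and so are Borel (`IsRegularValue.greedySet_ae_eq`).  Strict versions of the monotonicity show that
selecting and rejecting are equally good only for a null set of observations (`ae_value_ne`), so a
decision without loss agrees almost everywhere with the greedy one.

Since the next observation is uniform and independent of the current state, the optimality equation
can be summed along any adapted policy: its expected length plus the sum of the expected losses in
its decisions is the value of the starting state (`expectedLength_add_sum_expectedLoss`).  The
losses are nonnegative for feasible policies and vanish for the greedy policy, which is itself
feasible; so all losses of an optimal policy vanish (`IsOptimalFrom.expectedLoss_eq_zero`), and the
acceptance sets of an optimal Markov policy are greedy at almost every state it visits
(`IsMarkovPolicy.ae_eq_Icc`).  Applied from time `1` this gives the first two conclusions.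
Applied from time `i`, where the state is deterministic, it gives the third.
-/

namespace UnimodalSelection

/-! ### The value function -/

/-- The pair (last selected value, phase) after `x` has been selected in the state `p`. -/
noncomputable def nextState (x : unitInterval) (p : unitInterval × Bool) : unitInterval × Bool :=
  (x, p.2 || decide (x < p.1))

/-- The reward for an observation `x` presented in the state `p`, if it is selected exactly when
`c` holds and reaching a state `q` is worth `v q`. -/
noncomputable def reward (v : unitInterval × Bool → ℝ) (p : unitInterval × Bool) (x : unitInterval)
    (c : Prop) : ℝ :=
  open Classical in if c then 1 + v (nextState x p) else v p

/-- The larger of the rewards for selecting and for rejecting `x` in the state `p`; in the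
decreasing phase a value above the last selected one has to be rejected. -/
noncomputable def bestReward (v : unitInterval × Bool → ℝ) (p : unitInterval × Bool)
    (x : unitInterval) : ℝ :=
  if p.2 = true → x ≤ p.1 then max (v p) (1 + v (nextState x p)) else v p

/-- The optimal expected number of selections when `j` observations are still to come and the
state is `p`, defined by the optimality equation. -/
noncomputable def value : ℕ → unitInterval × Bool → ℝ
  | 0, _ => 0
  | j + 1, p => ∫ x, bestReward (value j) p x

/-- The observations that are worth selecting in the state `p`. -/
def greedySet (v : unitInterval × Bool → ℝ) (p : unitInterval × Bool) : Set unitInterval :=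
  {x | (p.2 = true → x ≤ p.1) ∧ v p ≤ 1 + v (nextState x p)}

/-- In the increasing phase a large last value is a burden, in the decreasing phase it is an
asset, and the increasing phase is never worse than the decreasing one. -/
structure IsRegularValue (v : unitInterval × Bool → ℝ) : Prop where
  mono : Monotone fun s => v (s, true)
  anti : Antitone fun s => v (s, false)
  le : ∀ s, v (s, true) ≤ v (s, false)

variable {v : unitInterval × Bool → ℝ}

theorem measurable_of_bool {α β : Type*} [MeasurableSpace α] [MeasurableSpace β] {f : α × Bool → β}
    (hf : ∀ r, Measurable fun s => f (s, r)) : Measurable f :=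
  measurable_from_prod_countable_left hf

theorem IsRegularValue.measurable (hv : IsRegularValue v) : Measurable v :=
  measurable_of_bool fun r => by
    cases r
    · exact hv.anti.measurable
    · exact hv.mono.measurable

theorem IsRegularValue.true_le_false (hv : IsRegularValue v) (s t : unitInterval) :
    v (s, true) ≤ v (t, false) :=
  (hv.mono (unitInterval.le_one' : s ≤ 1)).trans ((hv.le 1).trans (hv.anti unitInterval.le_one'))

theorem measurable_nextState :
    Measurable fun q : (unitInterval × Bool) × unitInterval => nextState q.2 q.1 := by
  refine Measurable.prodMk measurable_snd ?_
  have h : MeasurableSet {q : (unitInterval × Bool) × unitInterval | q.2 < q.1.1} :=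
    measurableSet_lt measurable_snd measurable_fst.fst
  refine measurable_to_bool ?_
  have : (fun q : (unitInterval × Bool) × unitInterval => (q.1.2 || decide (q.2 < q.1.1))) ⁻¹'
      {true} = {q | q.1.2 = true} ∪ {q | q.2 < q.1.1} := by
    ext q; simp
  rw [this]
  exact (measurable_fst.snd (measurableSet_singleton true)).union h

theorem measurableSet_admissible :
    MeasurableSet {q : (unitInterval × Bool) × unitInterval | q.1.2 = true → q.2 ≤ q.1.1} := by
  have : {q : (unitInterval × Bool) × unitInterval | q.1.2 = true → q.2 ≤ q.1.1} =
      {q | q.1.2 = true}ᶜ ∪ {q | q.2 ≤ q.1.1} := by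
    ext q
    simp only [Set.mem_ofPred_eq, Set.mem_union, Set.mem_compl_iff]
    tauto
  rw [this]
  exact (measurable_fst.snd (measurableSet_singleton true)).compl.union
    (measurableSet_le measurable_snd measurable_fst.fst)

theorem measurable_bestReward (hv : Measurable v) :
    Measurable fun q : (unitInterval × Bool) × unitInterval => bestReward v q.1 q.2 :=
  Measurable.ite measurableSet_admissible
    ((hv.comp measurable_fst).max (measurable_const.add (hv.comp measurable_nextState)))
    (hv.comp measurable_fst)

theorem measurable_reward (hv : Measurable v) {α : Type*} [MeasurableSpace α]
    {Z : α → unitInterval × Bool} {Y : α → unitInterval} (hZ : Measurable Z) (hY : Measurable Y)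
    {C : Set α} (hC : MeasurableSet C) :
    Measurable fun a => reward v (Z a) (Y a) (a ∈ C) := by
  classical
  unfold reward
  exact Measurable.ite hC (measurable_const.add (hv.comp (measurable_nextState.comp (hZ.prodMk hY))))
    (hv.comp hZ)

theorem abs_bestReward_le {C : ℝ} (hC : ∀ p, |v p| ≤ C) (p : unitInterval × Bool)
    (x : unitInterval) : |bestReward v p x| ≤ C + 1 := by
  have h1 := abs_le.1 (hC p)
  have h2 := abs_le.1 (hC (nextState x p))
  unfold bestReward
  split_ifs
  · rcases max_cases (v p) (1 + v (nextState x p)) with h | h <;> rw [h.1, abs_le] <;>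
      constructor <;> linarith
  · rw [abs_le]; constructor <;> linarith

theorem abs_reward_le {C : ℝ} (hC : ∀ p, |v p| ≤ C) (p : unitInterval × Bool)
    (x : unitInterval) (c : Prop) : |reward v p x c| ≤ C + 1 := by
  have h1 := abs_le.1 (hC p)
  have h2 := abs_le.1 (hC (nextState x p))
  unfold reward
  split_ifs <;> rw [abs_le] <;> constructor <;> linarith

theorem abs_value_le (j : ℕ) (p : unitInterval × Bool) : |value j p| ≤ j := by
  induction j generalizing p with
  | zero => simp [value]
  | succ j ih =>
    have := norm_integral_le_of_norm_le_const (μ := (volume : Measure unitInterval))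
      (f := bestReward (value j) p) (C := j + 1)
      (Filter.Eventually.of_forall fun x => abs_bestReward_le ih p x)
    simpa [value] using this

theorem integrable_bestReward (hv : Measurable v) {C : ℝ} (hC : ∀ p, |v p| ≤ C)
    (p : unitInterval × Bool) : Integrable (bestReward v p) :=
  Integrable.of_bound
    ((measurable_bestReward hv).comp measurable_prodMk_left).aestronglyMeasurable (C + 1)
    (Filter.Eventually.of_forall fun x => abs_bestReward_le hC p x)

theorem reward_le_bestReward {p : unitInterval × Bool} {x : unitInterval} {c : Prop}
    (h : c → p.2 = true → x ≤ p.1) : reward v p x c ≤ bestReward v p x := by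
  unfold reward bestReward
  by_cases hc : c
  · rw [if_pos hc, if_pos (h hc)]; exact le_max_right _ _
  · rw [if_neg hc]
    split_ifs
    · exact le_max_left _ _
    · exact le_rfl

theorem reward_greedySet (p : unitInterval × Bool) (x : unitInterval) :
    reward v p x (x ∈ greedySet v p) = bestReward v p x := by
  have hg : x ∈ greedySet v p ↔ (p.2 = true → x ≤ p.1) ∧ v p ≤ 1 + v (nextState x p) := Iff.rfl
  unfold reward bestReward
  by_cases h1 : p.2 = true → x ≤ p.1
  · by_cases h2 : v p ≤ 1 + v (nextState x p)
    · rw [if_pos (hg.2 ⟨h1, h2⟩), if_pos h1, max_eq_right h2]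
    · rw [if_neg fun h => h2 (hg.1 h).2, if_pos h1, max_eq_left (not_le.1 h2).le]
  · rw [if_neg fun h => h1 (hg.1 h).1, if_neg h1]

/-- Apart from ties, an admissible decision with the best possible reward is the greedy one. -/
theorem mem_greedySet_iff_of_reward_eq {p : unitInterval × Bool} {x : unitInterval} {c : Prop}
    (h : c → p.2 = true → x ≤ p.1) (hr : reward v p x c = bestReward v p x)
    (hx : (p.2 = true → x ≤ p.1) → v p ≠ 1 + v (nextState x p)) :
    c ↔ x ∈ greedySet v p := by
  unfold reward bestReward at hr
  constructor
  · intro hc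
    rw [if_pos hc, if_pos (h hc)] at hr
    exact (⟨h hc, hr ▸ le_max_left _ _⟩ : _ ∧ _)
  · intro hg
    by_contra hc
    rw [if_neg hc, if_pos hg.1] at hr
    exact hx hg.1 (le_antisymm hg.2 (hr ▸ le_max_right _ _))

theorem nextState_true (x s : unitInterval) : nextState x (s, true) = (x, true) := by
  simp [nextState]

theorem nextState_false_of_lt {x s : unitInterval} (h : x < s) :
    nextState x (s, false) = (x, true) := by
  simp [nextState, h]

theorem nextState_false_of_le {x s : unitInterval} (h : s ≤ x) :
    nextState x (s, false) = (x, false) := by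
  simp [nextState, h]

theorem bestReward_false (v : unitInterval × Bool → ℝ) (s x : unitInterval) :
    bestReward v (s, false) x = max (v (s, false)) (1 + v (nextState x (s, false))) := by
  simp [bestReward]

theorem bestReward_true_of_le (v : unitInterval × Bool → ℝ) {s x : unitInterval} (h : x ≤ s) :
    bestReward v (s, true) x = max (v (s, true)) (1 + v (x, true)) := by
  simp [bestReward, h, nextState_true]

theorem bestReward_true_of_lt (v : unitInterval × Bool → ℝ) {s x : unitInterval} (h : s < x) :
    bestReward v (s, true) x = v (s, true) := by
  simp [bestReward, h]

namespace IsRegularValue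

theorem bestReward_true_lt (hv : IsRegularValue v) {s s' x : unitInterval} (h : s < x)
    (h' : x ≤ s') : bestReward v (s, true) x < bestReward v (s', true) x := by
  rw [bestReward_true_of_lt v h, bestReward_true_of_le v h']
  have : v (s, true) ≤ v (x, true) := hv.mono h.le
  exact lt_max_of_lt_right (by linarith)

theorem bestReward_true_mono (hv : IsRegularValue v) {s s' : unitInterval} (h : s ≤ s')
    (x : unitInterval) : bestReward v (s, true) x ≤ bestReward v (s', true) x := by
  rcases le_or_gt x s with hx | hx
  · rw [bestReward_true_of_le v hx, bestReward_true_of_le v (hx.trans h)]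
    exact max_le_max (hv.mono h) le_rfl
  rcases le_or_gt x s' with hx' | hx'
  · exact (hv.bestReward_true_lt hx hx').le
  · rw [bestReward_true_of_lt v hx, bestReward_true_of_lt v hx']
    exact hv.mono h

theorem bestReward_false_anti (hv : IsRegularValue v) {s s' : unitInterval} (h : s ≤ s')
    (x : unitInterval) : bestReward v (s', false) x ≤ bestReward v (s, false) x := by
  rw [bestReward_false, bestReward_false]
  refine max_le_max (hv.anti h) (add_le_add le_rfl ?_)
  rcases lt_or_ge x s with hx | hx
  · rw [nextState_false_of_lt hx, nextState_false_of_lt (hx.trans_le h)]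
  rw [nextState_false_of_le hx]
  rcases lt_or_ge x s' with hx' | hx'
  · rw [nextState_false_of_lt hx']; exact hv.le x
  · rw [nextState_false_of_le hx']

theorem bestReward_false_lt (hv : IsRegularValue v) {s s' x : unitInterval} (h : s ≤ x)
    (h' : x < s') (hlt : v (x, true) < v (x, false)) :
    bestReward v (s', false) x < bestReward v (s, false) x := by
  rw [bestReward_false, bestReward_false, nextState_false_of_le h, nextState_false_of_lt h']
  have : v (s', false) ≤ v (x, false) := hv.anti h'.le
  exact lt_max_of_lt_right (max_lt (by linarith) (by linarith))

theorem bestReward_true_lt_false (hv : IsRegularValue v) {s x : unitInterval} (h : s < x) :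
    bestReward v (s, true) x < bestReward v (s, false) x := by
  rw [bestReward_true_of_lt v h, bestReward_false, nextState_false_of_le h.le]
  have := hv.true_le_false s x
  exact lt_max_of_lt_right (by linarith)

theorem bestReward_true_le_false (hv : IsRegularValue v) (s x : unitInterval) :
    bestReward v (s, true) x ≤ bestReward v (s, false) x := by
  rcases lt_trichotomy x s with h | rfl | h
  · rw [bestReward_true_of_le v h.le, bestReward_false, nextState_false_of_lt h]
    exact max_le_max (hv.le s) le_rfl
  · rw [bestReward_true_of_le v le_rfl, bestReward_false, nextState_false_of_le le_rfl]
    exact max_le_max (hv.le x) (add_le_add le_rfl (hv.le x))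
  · exact (hv.bestReward_true_lt_false h).le

end IsRegularValue

theorem isRegularValue_value (j : ℕ) : IsRegularValue (value j) := by
  induction j with
  | zero => exact ⟨fun _ _ _ => le_rfl, fun _ _ _ => le_rfl, fun _ => le_rfl⟩
  | succ j ih =>
    have hint := integrable_bestReward ih.measurable (abs_value_le j)
    exact ⟨fun s s' h => integral_mono (hint _) (hint _) (ih.bestReward_true_mono h),
      fun s s' h => integral_mono (hint _) (hint _) (ih.bestReward_false_anti h),
      fun s => integral_mono (hint _) (hint _) (ih.bestReward_true_le_false s)⟩

theorem measurable_value (j : ℕ) : Measurable (value j) :=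
  (isRegularValue_value j).measurable

theorem value_succ_lt {j : ℕ} {p q : unitInterval × Bool} {s t : unitInterval} (hst : s < t)
    (hle : ∀ x, bestReward (value j) p x ≤ bestReward (value j) q x)
    (hlt : ∀ x ∈ Set.Ioo s t, bestReward (value j) p x < bestReward (value j) q x) :
    value (j + 1) p < value (j + 1) q := by
  have hint := integrable_bestReward (measurable_value j) (abs_value_le j)
  rw [← sub_pos]
  change 0 < (∫ x, bestReward (value j) q x) - ∫ x, bestReward (value j) p x
  rw [← integral_sub (hint q) (hint p), integral_pos_iff_support_of_nonneg
    (fun x => sub_nonneg.2 (hle x)) ((hint q).sub (hint p))]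
  refine lt_of_lt_of_le ?_ (measure_mono fun x hx => (sub_pos.2 (hlt x hx)).ne')
  rw [unitInterval.volume_Ioo]
  simpa using hst

theorem strictMono_value_true (j : ℕ) : StrictMono fun s => value (j + 1) (s, true) :=
  fun _ _ h => value_succ_lt h ((isRegularValue_value j).bestReward_true_mono h.le)
    fun _ hx => (isRegularValue_value j).bestReward_true_lt hx.1 hx.2.le

theorem value_true_lt_false (j : ℕ) {s : unitInterval} (h : s < 1) :
    value (j + 1) (s, true) < value (j + 1) (s, false) :=
  value_succ_lt h ((isRegularValue_value j).bestReward_true_le_false s)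
    fun _ hx => (isRegularValue_value j).bestReward_true_lt_false hx.1

/-- With a single observation left, every last value has the same worth in the increasing phase,
so strictness needs two of them. -/
theorem strictAnti_value_false (j : ℕ) : StrictAnti fun s => value (j + 2) (s, false) :=
  fun _ _ h => value_succ_lt h ((isRegularValue_value (j + 1)).bestReward_false_anti h.le)
    fun _ hx => (isRegularValue_value (j + 1)).bestReward_false_lt hx.1.le hx.2
      (value_true_lt_false j (hx.2.trans_le unitInterval.le_one'))

theorem value_one_false (s : unitInterval) : value 1 (s, false) = 1 := by
  simp [value, bestReward_false]

/-- Selecting and rejecting are equally good only for a null set of observations. -/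
theorem ae_value_ne (j : ℕ) (p : unitInterval × Bool) :
    ∀ᵐ x : unitInterval, (p.2 = true → x ≤ p.1) → value j p ≠ 1 + value j (nextState x p) := by
  rcases j with _ | j
  · exact Filter.Eventually.of_forall fun x _ => by simp [value]
  obtain ⟨s, r⟩ := p
  have h1 : {x | value (j + 1) (s, r) = 1 + value (j + 1) (x, true)}.Subsingleton :=
    fun x hx y hy => (strictMono_value_true j).injective
      (by simp only [Set.mem_ofPred_eq] at hx hy ⊢; linarith)
  have h2 : {x | value (j + 1) (s, false) = 1 + value (j + 1) (x, false)}.Subsingleton := by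
    intro x hx y hy
    rcases j with _ | j
    · simp [value_one_false] at hx
    · exact (strictAnti_value_false j).injective
        (by simp only [Set.mem_ofPred_eq] at hx hy ⊢; linarith)
  filter_upwards [measure_eq_zero_iff_ae_notMem.1 (h1.measure_zero _),
    measure_eq_zero_iff_ae_notMem.1 (h2.measure_zero _)] with x hx1 hx2 hx
  cases r
  · rcases lt_or_ge x s with h | h
    · rwa [nextState_false_of_lt h]
    · rwa [nextState_false_of_le h]
  · rwa [nextState_true]

/-! ### The greedy sets are intervals -/

/-- The left endpoint of the interval that agrees with `greedySet v (s, r)` up to a null set. -/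
noncomputable def greedyLeft (v : unitInterval × Bool → ℝ) (s : unitInterval) (r : Bool) :
    unitInterval :=
  min s (sInf {x | v (s, r) ≤ 1 + v (x, true)})

/-- The right endpoint of the interval that agrees with `greedySet v (s, r)` up to a null set. -/
noncomputable def greedyRight (v : unitInterval × Bool → ℝ) (s : unitInterval) :
    Bool → unitInterval
  | false => max s (sSup {x | v (s, false) ≤ 1 + v (x, false)})
  | true => s

theorem IsRegularValue.measurable_greedyLeft (hv : IsRegularValue v) (r : Bool) :
    Measurable fun s => greedyLeft v s r := by
  refine measurable_id.min ?_
  cases r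
  · refine Antitone.measurable fun s s' h => sInf_le_sInf fun x hx => ?_
    exact (hv.anti h).trans hx
  · refine Monotone.measurable fun s s' h => sInf_le_sInf fun x hx => ?_
    exact (hv.mono h).trans hx

theorem IsRegularValue.measurable_greedyRight (hv : IsRegularValue v) (r : Bool) :
    Measurable fun s => greedyRight v s r := by
  cases r
  · refine measurable_id.max (Monotone.measurable fun s s' h => sSup_le_sSup fun x hx => ?_)
    exact (hv.anti h).trans hx
  · exact measurable_id

theorem IsRegularValue.greedySet_ae_eq (hv : IsRegularValue v) (s : unitInterval) (r : Bool) :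
    greedySet v (s, r) =ᵐ[volume] Set.Icc (greedyLeft v s r) (greedyRight v s r) := by
  set l : unitInterval := sInf {x | v (s, r) ≤ 1 + v (x, true)}
  set u : unitInterval := sSup {x | v (s, false) ≤ 1 + v (x, false)}
  have hlx : ∀ x, x ≠ l → (v (s, r) ≤ 1 + v (x, true) ↔ l ≤ x) := by
    refine fun x hx => ⟨fun h => sInf_le h, fun h => ?_⟩
    obtain ⟨y, hy, hyx⟩ := sInf_lt_iff.1 (lt_of_le_of_ne h hx.symm)
    have : v (y, true) ≤ v (x, true) := hv.mono hyx.le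
    exact le_trans hy (by linarith)
  have hux : ∀ x, x ≠ u → (v (s, false) ≤ 1 + v (x, false) ↔ x ≤ u) := by
    refine fun x hx => ⟨fun h => le_sSup h, fun h => ?_⟩
    obtain ⟨y, hy, hyx⟩ := lt_sSup_iff.1 (lt_of_le_of_ne h hx)
    have : v (y, false) ≤ v (x, false) := hv.anti hyx.le
    exact le_trans hy (by linarith)
  have hne : ∀ c : unitInterval, ∀ᵐ x : unitInterval, x ≠ c := fun c =>
    measure_eq_zero_iff_ae_notMem.1 (measure_singleton c)
  filter_upwards [hne l, hne u, hne s] with x hxl hxu hxs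
  refine propext ?_
  change ((r = true → x ≤ s) ∧ v (s, r) ≤ 1 + v (nextState x (s, r))) ↔
    greedyLeft v s r ≤ x ∧ x ≤ greedyRight v s r
  have hL : greedyLeft v s r ≤ x ↔ s ≤ x ∨ l ≤ x := min_le_iff
  rw [hL]
  rcases lt_or_gt_of_ne hxs with h | h
  · have hR : x ≤ greedyRight v s r := by
      cases r
      · exact h.le.trans (le_max_left _ _)
      · exact h.le
    have hN : nextState x (s, r) = (x, true) := by simp [nextState, h]
    rw [hN, hlx x hxl]
    simp [hR, h.le, h.not_ge]
  · cases r
    · have hR : x ≤ greedyRight v s false ↔ x ≤ s ∨ x ≤ u := le_max_iff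
      rw [nextState_false_of_le h.le, hux x hxu, hR]
      simp [h.le, h.not_ge]
    · simp [greedyRight, h.not_ge]

/-! ### Policies and their states -/

section Policies

variable {Ω : Type*}

/-- The pair (last selected value, phase) after the `k`-th observation, if the `k`-th observation
is selected on the event `A k` and the pair just before the `m`-th observation is `p`.  Unlike
`stateFrom`, this makes sense for policies that are not Markov. -/
noncomputable def runState (X : ℕ → Ω → unitInterval) (A : ℕ → Set Ω) (m : ℕ)
    (p : unitInterval × Bool) : ℕ → Ω → unitInterval × Bool
  | 0, _ => p
  | k + 1, ω => open Classical in
    if k + 1 < m then p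
    else if ω ∈ A (k + 1) then nextState (X (k + 1) ω) (runState X A m p k ω)
    else runState X A m p k ω

variable {X : ℕ → Ω → unitInterval} {A : ℕ → Set Ω} {m n : ℕ} {p : unitInterval × Bool}

theorem runState_of_lt {k : ℕ} (h : k < m) (ω : Ω) : runState X A m p k ω = p := by
  cases k with
  | zero => rfl
  | succ k => exact if_pos h

theorem runState_succ_of_mem {k : ℕ} (h : m ≤ k + 1) {ω : Ω} (hω : ω ∈ A (k + 1)) :
    runState X A m p (k + 1) ω = nextState (X (k + 1) ω) (runState X A m p k ω) := by
  rw [runState, if_neg h.not_gt, if_pos hω]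

theorem runState_succ_of_notMem {k : ℕ} {ω : Ω} (hω : ω ∉ A (k + 1)) :
    runState X A m p (k + 1) ω = runState X A m p k ω := by
  rw [runState, if_neg hω]
  split_ifs with h
  · exact (runState_of_lt ((Nat.lt_succ_self k).trans h) ω).symm
  · rfl

/-- Every selection made in the decreasing phase is at most the last selected value. -/
def IsAdmissible (X : ℕ → Ω → unitInterval) (n m : ℕ) (p : unitInterval × Bool)
    (A : ℕ → Set Ω) : Prop :=
  ∀ k, m ≤ k + 1 → k + 1 ≤ n → ∀ ω ∈ A (k + 1),
    (runState X A m p k ω).2 = true → X (k + 1) ω ≤ (runState X A m p k ω).1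

theorem stateFrom_eq_runState (D : ℕ → unitInterval → Bool → Set unitInterval) (k : ℕ) (ω : Ω) :
    stateFrom D (fun j => X j ω) m p k =
      runState X (selectionEventFrom D X m p) m p k ω := by
  induction k with
  | zero => rfl
  | succ k ih =>
    by_cases hk : k + 1 < m
    · rw [runState_of_lt hk]
      exact if_pos hk
    have hs : stateFrom D (fun j => X j ω) m p (k + 1) =
      step (D (k + 1)) (X (k + 1) ω) (stateFrom D (fun j => X j ω) m p k) := if_neg hk
    rw [hs]
    by_cases hω : ω ∈ selectionEventFrom D X m p (k + 1)
    · rw [runState_succ_of_mem (not_lt.1 hk) hω, ← ih]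
      exact if_pos hω
    · rw [runState_succ_of_notMem hω, ← ih]
      exact if_neg hω

/-! ### Admissibility and unimodality -/

/-- The values `X k ω` with the value `s` in front, at the index `m - 1`. -/
abbrev frontSeq (X : ℕ → Ω → unitInterval) (ω : Ω) (m : ℕ) (s : unitInterval) : ℕ → unitInterval :=
  Function.update (fun k => X k ω) (m - 1) s

/-- The selected indices with the index `m - 1` of the last earlier selection in front. -/
abbrev frontIndices (A : ℕ → Set Ω) (m n : ℕ) (ω : Ω) : Set ℕ :=
  insert (m - 1) (selectedIndices A m n ω)

theorem frontSeq_of_le {s : unitInterval} {k : ℕ} {ω : Ω} (hm : 1 ≤ m) (h : m ≤ k) :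
    frontSeq X ω m s k = X k ω :=
  Function.update_of_ne (by omega) _ _

theorem frontSeq_self {s : unitInterval} {ω : Ω} : frontSeq X ω m s (m - 1) = s :=
  Function.update_self _ _ _

theorem mem_frontIndices {k : ℕ} {ω : Ω} (h : m ≤ k) (hn : k ≤ n) (hω : ω ∈ A k) :
    k ∈ frontIndices A m n ω :=
  Or.inr ⟨Finset.mem_Icc.2 ⟨h, hn⟩, hω⟩

/-- The current value is the value of some selected index, and the decreasing phase is reached only
through a decrease among the selected values. -/
theorem runState_spec (hm : 1 ≤ m) (s : unitInterval) (r : Bool) (ω : Ω) (k : ℕ) (hk : m ≤ k + 1)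
    (hkn : k ≤ n) :
    ∃ l ∈ frontIndices A m n ω, l ≤ k ∧
      (runState X A m (s, r) k ω).1 = frontSeq X ω m s l ∧
      ((runState X A m (s, r) k ω).2 = true → r = true ∨
        ∃ i ∈ frontIndices A m n ω, ∃ j ∈ frontIndices A m n ω, i < j ∧ j ≤ l ∧
          frontSeq X ω m s j < frontSeq X ω m s i) := by
  induction k with
  | zero =>
    obtain rfl : m = 1 := by omega
    exact ⟨0, Or.inl rfl, le_rfl, frontSeq_self.symm, fun h => Or.inl h⟩
  | succ k ih =>
    rcases Nat.lt_or_ge (k + 1) m with hkm | hkm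
    · rw [runState_of_lt hkm]
      exact ⟨m - 1, Or.inl rfl, by omega, frontSeq_self.symm, fun h => Or.inl h⟩
    obtain ⟨l, hl, hlk, h1, h2⟩ := ih hkm (by omega)
    by_cases hω : ω ∈ A (k + 1)
    · have hk1 : k + 1 ∈ frontIndices A m n ω := mem_frontIndices hkm hkn hω
      have hx : frontSeq X ω m s (k + 1) = X (k + 1) ω := frontSeq_of_le hm hkm
      rw [runState_succ_of_mem hkm hω]
      refine ⟨k + 1, hk1, le_rfl, hx.symm, fun h => ?_⟩
      simp only [nextState, Bool.or_eq_true, decide_eq_true_eq] at h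
      rcases h with h | h
      · rcases h2 h with h | ⟨i, hi, j, hj, hij, hjl, hlt⟩
        · exact Or.inl h
        · exact Or.inr ⟨i, hi, j, hj, hij, by omega, hlt⟩
      · exact Or.inr ⟨l, hl, k + 1, hk1, by omega, le_rfl, by rw [hx, ← h1]; exact h⟩
    · rw [runState_succ_of_notMem hω]
      exact ⟨l, hl, by omega, h1, h2⟩

theorem IsFeasibleFrom.isAdmissible {s : unitInterval} {r : Bool} (hm : 1 ≤ m)
    (hA : IsFeasibleFrom X n m s r A) : IsAdmissible X n m (s, r) A := by
  intro k hk hkn ω hω hphase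
  obtain ⟨l, hl, hlk, h1, h2⟩ := runState_spec hm s r ω k hk (A := A) (X := X) (n := n) (by omega)
  have hk1 : k + 1 ∈ frontIndices A m n ω := mem_frontIndices hk hkn hω
  have hx : frontSeq X ω m s (k + 1) = X (k + 1) ω := frontSeq_of_le hm hk
  rw [h1, ← hx]
  by_cases hr : r = true
  · exact hA.antitone hr ω hl hk1 (by omega)
  obtain ⟨t, hmono, hanti⟩ := hA.unimodal (by simpa using hr) ω
  obtain ⟨i, hi, j, hj, hij, hjl, hlt⟩ := (h2 hphase).resolve_left hr
  -- A decrease from `i` to `j` forces the peak `t` to lie before `j`, hence before `l`.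
  have htj : t < j := by
    by_contra hjt
    have hjt' : j ≤ t := not_lt.1 hjt
    exact hlt.not_ge (hmono ⟨hi, (hij.le.trans hjt' : i ≤ t)⟩ ⟨hj, hjt'⟩ hij.le)
  exact hanti ⟨hl, (by omega : t ≤ l)⟩ ⟨hk1, (by omega : t ≤ k + 1)⟩ (by omega)

theorem mem_frontIndices_iff {k : ℕ} {ω : Ω} :
    k ∈ frontIndices A m n ω ↔ k = m - 1 ∨ (m ≤ k ∧ k ≤ n) ∧ ω ∈ A k := by
  rw [← Finset.mem_Icc]
  rfl

theorem runState_fst_of_mem {s : unitInterval} {r : Bool} (hm : 1 ≤ m) {k : ℕ} {ω : Ω}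
    (h : k ∈ frontIndices A m n ω) : (runState X A m (s, r) k ω).1 = frontSeq X ω m s k := by
  rcases mem_frontIndices_iff.1 h with rfl | ⟨⟨hk, -⟩, hω⟩
  · rw [runState_of_lt (by omega), frontSeq_self]
  · obtain ⟨k, rfl⟩ : ∃ k', k = k' + 1 := ⟨k - 1, by omega⟩
    rw [runState_succ_of_mem hk hω, frontSeq_of_le hm hk]
    rfl

theorem le_of_mem_frontIndices_of_notMem {k i : ℕ} {ω : Ω} (hk : m ≤ k + 1) (hm : 1 ≤ m)
    (hω : ω ∉ A (k + 1)) (hi : i ∈ frontIndices A m n ω) (hik : i ≤ k + 1) : i ≤ k := by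
  rcases mem_frontIndices_iff.1 hi with rfl | ⟨-, hiω⟩
  · omega
  · rcases Nat.lt_or_ge k i with h | h
    · obtain rfl : i = k + 1 := by omega
      exact absurd hiω hω
    · exact h

/-- As long as the phase is increasing, the selected values increase up to the current one. -/
theorem monotone_of_phase_false {s : unitInterval} {r : Bool} (hm : 1 ≤ m) (ω : Ω) (k : ℕ)
    (hk : m ≤ k + 1) (hphase : (runState X A m (s, r) k ω).2 = false) :
    r = false ∧
      (∀ i ∈ frontIndices A m n ω, i ≤ k → frontSeq X ω m s i ≤ (runState X A m (s, r) k ω).1) ∧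
      ∀ i ∈ frontIndices A m n ω, ∀ j ∈ frontIndices A m n ω, i ≤ j → j ≤ k →
        frontSeq X ω m s i ≤ frontSeq X ω m s j := by
  -- It is enough to bound the values by the current one, at all times.
  suffices H : ∀ k, m ≤ k + 1 → (runState X A m (s, r) k ω).2 = false → r = false ∧
      (∀ i ∈ frontIndices A m n ω, i ≤ k →
        frontSeq X ω m s i ≤ (runState X A m (s, r) k ω).1) ∧
      ∀ l, m ≤ l + 1 → l ≤ k → (runState X A m (s, r) l ω).2 = false by
    refine ⟨(H k hk hphase).1, (H k hk hphase).2.1, fun i hi j hj hij hjk => ?_⟩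
    have hmj : m ≤ j + 1 := by rcases mem_frontIndices_iff.1 hj with h | h <;> omega
    rw [← runState_fst_of_mem (X := X) (r := r) hm hj]
    exact (H j hmj ((H k hk hphase).2.2 j hmj hjk)).2.1 i hi hij
  clear hphase hk k
  intro k hk hphase
  have base : ∀ k, k + 1 = m → (runState X A m (s, r) k ω).2 = false → r = false ∧
      (∀ i ∈ frontIndices A m n ω, i ≤ k →
        frontSeq X ω m s i ≤ (runState X A m (s, r) k ω).1) ∧
      ∀ l, m ≤ l + 1 → l ≤ k → (runState X A m (s, r) l ω).2 = false := by
    rintro k rfl h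
    refine ⟨by rwa [runState_of_lt k.lt_succ_self] at h, fun i hi hik => ?_, fun l hl hlk => ?_⟩
    · obtain rfl : i = k := by rcases mem_frontIndices_iff.1 hi with h | h <;> omega
      rw [runState_fst_of_mem hm hi]
    · obtain rfl : l = k := by omega
      exact h
  induction k with
  | zero => exact base 0 (by omega) hphase
  | succ k ih =>
    rcases Nat.lt_or_ge (k + 1) m with hkm | hkm
    · exact base _ (by omega) hphase
    by_cases hω : ω ∈ A (k + 1)
    · have hst := runState_succ_of_mem (X := X) (p := (s, r)) hkm hω
      have h' := hphase
      rw [hst] at h'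
      simp only [nextState, Bool.or_eq_false_iff, decide_eq_false_iff_not, not_lt] at h'
      obtain ⟨h1, h2, h3⟩ := ih hkm h'.1
      refine ⟨h1, fun i hi hik => ?_, fun l hl hlk => ?_⟩
      · rcases Nat.lt_or_ge k i with h | h
        · obtain rfl : i = k + 1 := by omega
          rw [runState_fst_of_mem hm hi]
        · rw [hst]
          exact (h2 i hi h).trans h'.2
      · rcases Nat.lt_or_ge k l with h | h
        · obtain rfl : l = k + 1 := by omega
          exact hphase
        · exact h3 l hl h
    · have hst := runState_succ_of_notMem (X := X) (m := m) (p := (s, r)) hω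
      obtain ⟨h1, h2, h3⟩ := ih hkm (by rwa [hst] at hphase)
      refine ⟨h1, fun i hi hik => ?_, fun l hl hlk => ?_⟩
      · rw [hst]
        exact h2 i hi (le_of_mem_frontIndices_of_notMem hkm hm hω hi hik)
      · rcases Nat.lt_or_ge k l with h | h
        · obtain rfl : l = k + 1 := by omega
          exact hphase
        · exact h3 l hl h

/-- Under an admissible policy, the values selected up to a time in the decreasing phase increase
up to some index `t` and decrease from there on. -/
theorem IsAdmissible.exists_peak {s : unitInterval} {r : Bool} (hm : 1 ≤ m)
    (hA : IsAdmissible X n m (s, r) A) (ω : Ω) (k : ℕ) (hk : m ≤ k + 1) (hkn : k ≤ n)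
    (hphase : (runState X A m (s, r) k ω).2 = true) :
    ∃ t ≤ k, (r = true → t = m - 1) ∧
      (∀ i ∈ frontIndices A m n ω, ∀ j ∈ frontIndices A m n ω, i ≤ j → j ≤ t →
        frontSeq X ω m s i ≤ frontSeq X ω m s j) ∧
      (∀ i ∈ frontIndices A m n ω, t ≤ i → i ≤ k →
        (runState X A m (s, r) k ω).1 ≤ frontSeq X ω m s i) ∧
      ∀ i ∈ frontIndices A m n ω, ∀ j ∈ frontIndices A m n ω, t ≤ i → i ≤ j → j ≤ k →
        frontSeq X ω m s j ≤ frontSeq X ω m s i := by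
  have base : ∀ k, k + 1 = m → ∃ t ≤ k, (r = true → t = m - 1) ∧
      (∀ i ∈ frontIndices A m n ω, ∀ j ∈ frontIndices A m n ω, i ≤ j → j ≤ t →
        frontSeq X ω m s i ≤ frontSeq X ω m s j) ∧
      (∀ i ∈ frontIndices A m n ω, t ≤ i → i ≤ k →
        (runState X A m (s, r) k ω).1 ≤ frontSeq X ω m s i) ∧
      ∀ i ∈ frontIndices A m n ω, ∀ j ∈ frontIndices A m n ω, t ≤ i → i ≤ j → j ≤ k →
        frontSeq X ω m s j ≤ frontSeq X ω m s i := by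
    rintro k rfl
    have hge : ∀ i ∈ frontIndices A (k + 1) n ω, k ≤ i := fun i hi => by
      rcases mem_frontIndices_iff.1 hi with h | h <;> omega
    refine ⟨k, le_rfl, fun _ => rfl, fun i hi j hj hij hjk => ?_, fun i hi hki hik => ?_,
      fun i hi j hj hki hij hjk => ?_⟩
    · obtain rfl : i = j := by have := hge i hi; omega
      exact le_rfl
    · obtain rfl : i = k := by omega
      rw [runState_fst_of_mem hm hi]
    · obtain rfl : i = j := by omega
      exact le_rfl
  induction k with
  | zero => exact base 0 (by omega)
  | succ k ih =>
    rcases Nat.lt_or_ge (k + 1) m with hkm | hkm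
    · exact base _ (by omega)
    by_cases hω : ω ∈ A (k + 1)
    · have hst := runState_succ_of_mem (X := X) (p := (s, r)) hkm hω
      have hk1 : k + 1 ∈ frontIndices A m n ω := mem_frontIndices hkm hkn hω
      have hx : frontSeq X ω m s (k + 1) = X (k + 1) ω := frontSeq_of_le hm hkm
      cases hR : (runState X A m (s, r) k ω).2 with
      | true =>
        have hle := hA k hkm hkn ω hω hR
        obtain ⟨t, htk, ht, hmono, hcur, hanti⟩ := ih hkm (by omega) hR
        refine ⟨t, by omega, ht, hmono, fun i hi hti hik => ?_, fun i hi j hj hti hij hjk => ?_⟩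
        · rcases Nat.lt_or_ge k i with h | h
          · obtain rfl : i = k + 1 := by omega
            rw [runState_fst_of_mem hm hi]
          · rw [hst]
            exact hle.trans (hcur i hi hti h)
        · rcases Nat.lt_or_ge k j with h | h
          · obtain rfl : j = k + 1 := by omega
            rcases Nat.lt_or_ge k i with h' | h'
            · obtain rfl : i = k + 1 := by omega
              exact le_rfl
            · rw [hx]
              exact hle.trans (hcur i hi hti h')
          · exact hanti i hi j hj hti hij h
      | false =>
        -- The first decrease occurs now, so the peak is the last value selected so far.
        obtain ⟨hr, -, hmono⟩ := monotone_of_phase_false (n := n) hm ω k hkm hR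
        have hlt : X (k + 1) ω < (runState X A m (s, r) k ω).1 := by
          rw [hst] at hphase
          simpa [nextState, hR] using hphase
        have hcase : ∀ i ∈ frontIndices A m n ω, k ≤ i → i ≤ k + 1 →
            frontSeq X ω m s (k + 1) ≤ frontSeq X ω m s i := fun i hi hki hik => by
          rcases Nat.lt_or_ge k i with h | h
          · obtain rfl : i = k + 1 := by omega
            exact le_rfl
          · obtain rfl : i = k := by omega
            rw [hx, ← runState_fst_of_mem (X := X) (r := r) hm hi]
            exact hlt.le
        refine ⟨k, by omega, by simp [hr], hmono, fun i hi hki hik => ?_,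
          fun i hi j hj hki hij hjk => ?_⟩
        · rw [runState_fst_of_mem hm hk1]
          exact hcase i hi hki hik
        · rcases Nat.lt_or_ge k j with h | h
          · obtain rfl : j = k + 1 := by omega
            exact hcase i hi hki hij
          · obtain rfl : i = j := by omega
            exact le_rfl
    · have hst := runState_succ_of_notMem (X := X) (m := m) (p := (s, r)) hω
      have hle := fun i => le_of_mem_frontIndices_of_notMem (n := n) (i := i) hkm hm hω
      rw [hst] at hphase ⊢
      obtain ⟨t, htk, ht, hmono, hcur, hanti⟩ := ih hkm (by omega) hphase
      exact ⟨t, by omega, ht, hmono, fun i hi hti hik => hcur i hi hti (hle i hi hik),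
        fun i hi j hj hti hij hjk => hanti i hi j hj hti hij (hle j hj hjk)⟩

theorem IsAdmissible.isFeasibleFrom {s : unitInterval} {r : Bool} (hm : 1 ≤ m) (hmn : m ≤ n + 1)
    (hadapted : ∀ k ∈ Finset.Icc m n, MeasurableSet[history X k] (A k))
    (hA : IsAdmissible X n m (s, r) A) : IsFeasibleFrom X n m s r A := by
  have hle : ∀ ω, ∀ i ∈ frontIndices A m n ω, i ≤ n := fun ω i hi => by
    rcases mem_frontIndices_iff.1 hi with h | h <;> omega
  have hge : ∀ ω, ∀ i ∈ frontIndices A m n ω, m - 1 ≤ i := fun ω i hi => by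
    rcases mem_frontIndices_iff.1 hi with h | h <;> omega
  refine ⟨hadapted, fun hr ω => ?_, fun hr ω => ?_⟩
  · cases hR : (runState X A m (s, r) n ω).2 with
    | false =>
      obtain ⟨-, -, hmono⟩ := monotone_of_phase_false (n := n) hm ω n hmn hR
      refine ⟨n, fun i hi j hj hij => hmono i hi.1 j hj.1 hij (hle ω j hj.1),
        fun i hi j hj hij => ?_⟩
      obtain rfl : i = j := le_antisymm hij ((hle ω j hj.1).trans hi.2)
      exact le_rfl
    | true =>
      obtain ⟨t, -, -, hmono, -, hanti⟩ := hA.exists_peak hm ω n hmn le_rfl hR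
      exact ⟨t, fun i hi j hj hij => hmono i hi.1 j hj.1 hij hj.2,
        fun i hi j hj hij => hanti i hi.1 j hj.1 hi.2 hij (hle ω j hj.1)⟩
  · cases hR : (runState X A m (s, r) n ω).2 with
    | false =>
      have := (monotone_of_phase_false (n := n) hm ω n hmn hR).1
      simp [this] at hr
    | true =>
      obtain ⟨t, -, ht, -, -, hanti⟩ := hA.exists_peak hm ω n hmn le_rfl hR
      exact fun i hi j hj hij =>
        hanti i hi j hj (ht hr ▸ hge ω i hi) hij (hle ω j hj)

/-- The full problem is the problem that starts from the value `0` in the increasing phase: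
a value `0` in front does not restrict the selections. -/
theorem isFeasible_iff_isFeasibleFrom : IsFeasible X n A ↔ IsFeasibleFrom X n 1 0 false A := by
  have hne : ∀ ω, ∀ i ∈ selectedIndices A 1 n ω, 1 ≤ i := fun ω i hi =>
    (Finset.mem_Icc.1 hi.1).1
  have hs : ∀ ω, ∀ i ∈ selectedIndices A 1 n ω, frontSeq X ω 1 0 i = X i ω := fun ω i hi =>
    frontSeq_of_le le_rfl (hne ω i hi)
  have h0 : ∀ ω, frontSeq X ω 1 0 0 = 0 := fun ω => frontSeq_self (m := 1)
  refine ⟨fun h => ⟨h.adapted, fun _ ω => ?_, fun h => by simp at h⟩,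
    fun h => ⟨h.adapted, fun ω => ?_⟩⟩
  · obtain ⟨t, hmono, hanti⟩ := h.unimodal ω
    -- The peak is moved to a positive index, so that the decreasing part does not contain the
    -- front value.
    refine ⟨max t 1, ?_, ?_⟩
    · rintro i ⟨hi, hit⟩ j ⟨hj, hjt⟩ hij
      change frontSeq X ω 1 0 i ≤ frontSeq X ω 1 0 j
      rcases hi with rfl | hi
      · rw [show (1 - 1 : ℕ) = 0 from rfl, h0]
        exact unitInterval.nonneg'
      have hi1 := hne ω i hi
      rcases hj with rfl | hj
      · omega
      rw [hs ω i hi, hs ω j hj]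
      rcases le_max_iff.1 (show j ≤ max t 1 from hjt) with h | h
      · exact hmono ⟨hi, (hij.trans h : i ≤ t)⟩ ⟨hj, h⟩ hij
      · obtain rfl : i = j := by omega
        exact le_rfl
    · rintro i ⟨hi, hti⟩ j ⟨hj, htj⟩ hij
      change frontSeq X ω 1 0 j ≤ frontSeq X ω 1 0 i
      have hti' : max t 1 ≤ i := hti
      have htj' : max t 1 ≤ j := htj
      have hi' := hi.resolve_left (by omega)
      have hj' := hj.resolve_left (by omega)
      rw [hs ω i hi', hs ω j hj']
      exact hanti ⟨hi', (le_max_left _ _).trans hti'⟩ ⟨hj', (le_max_left _ _).trans htj'⟩ hij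
  · obtain ⟨t, hmono, hanti⟩ := h.unimodal rfl ω
    refine ⟨t, fun i hi j hj hij => ?_, fun i hi j hj hij => ?_⟩
    · have := hmono ⟨Or.inr hi.1, hi.2⟩ ⟨Or.inr hj.1, hj.2⟩ hij
      change frontSeq X ω 1 0 i ≤ frontSeq X ω 1 0 j at this
      rwa [hs ω i hi.1, hs ω j hj.1] at this
    · have := hanti ⟨Or.inr hi.1, hi.2⟩ ⟨Or.inr hj.1, hj.2⟩ hij
      change frontSeq X ω 1 0 j ≤ frontSeq X ω 1 0 i at this
      rwa [hs ω i hi.1, hs ω j hj.1] at this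

end Policies

/-! ### Measurability and independence of the states -/

section Probability

variable {Ω : Type*} {X : ℕ → Ω → unitInterval} {A : ℕ → Set Ω} {m n : ℕ}
  {p : unitInterval × Bool}

theorem history_mono (X : ℕ → Ω → unitInterval) {k l : ℕ} (h : k ≤ l) :
    history X k ≤ history X l :=
  biSup_mono fun _ hj => Finset.Icc_subset_Icc_right h hj

theorem measurable_history {k : ℕ} (hk : 1 ≤ k) : Measurable[history X k] (X k) :=
  Measurable.mono (comap_measurable (X k))
    (le_biSup (fun j => MeasurableSpace.comap (X j) inferInstance)
      (Finset.mem_Icc.2 ⟨hk, le_rfl⟩)) le_rfl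

theorem measurable_runState {k : ℕ}
    (hA : ∀ j, m ≤ j → j ≤ k → MeasurableSet[history X j] (A j)) :
    Measurable[history X k] (runState X A m p k) := by
  classical
  induction k with
  | zero => exact measurable_const
  | succ k ih =>
    have hZ : Measurable[history X (k + 1)] (runState X A m p k) :=
      (ih fun j hj hjk => hA j hj (by omega)).mono (history_mono X k.le_succ) le_rfl
    by_cases hk : k + 1 < m
    · have : runState X A m p (k + 1) = fun _ => p := funext (runState_of_lt hk)
      rw [this]
      exact measurable_const
    · have : runState X A m p (k + 1) = fun ω => if ω ∈ A (k + 1) then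
          nextState (X (k + 1) ω) (runState X A m p k ω) else runState X A m p k ω := by
        ext1 ω
        split_ifs with hω
        · exact runState_succ_of_mem (not_lt.1 hk) hω
        · exact runState_succ_of_notMem hω
      rw [this]
      exact Measurable.ite (hA _ (not_lt.1 hk) le_rfl) (measurable_nextState.comp
        (hZ.prodMk (measurable_history k.succ_pos))) hZ

theorem measurableSet_acceptance {E : unitInterval → Bool → Set unitInterval}
    (hE : ∀ r, MeasurableSet {q : unitInterval × unitInterval | q.2 ∈ E q.1 r}) :
    MeasurableSet {q : (unitInterval × Bool) × unitInterval | q.2 ∈ E q.1.1 q.1.2} := by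
  have hE' : ∀ r, MeasurableSet {q : (unitInterval × Bool) × unitInterval |
      q.1.2 = r ∧ q.2 ∈ E q.1.1 r} := fun r =>
    (measurable_fst.snd (measurableSet_singleton r)).inter
      ((measurable_fst.fst.prodMk measurable_snd) (hE r))
  convert (hE' true).union (hE' false) using 1
  ext ⟨⟨s, r⟩, x⟩
  cases r <;> simp

/-- The events on which a Markov policy selects are adapted to the observations. -/
theorem IsMarkovPolicy.adapted {D : ℕ → unitInterval → Bool → Set unitInterval}
    (hD : IsMarkovPolicy n D) (hm : 1 ≤ m) (k : ℕ) (hk : m ≤ k) (hkn : k ≤ n) :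
    MeasurableSet[history X k] (selectionEventFrom D X m p k) := by
  induction k using Nat.strong_induction_on with
  | _ k ih =>
    obtain ⟨k, rfl⟩ : ∃ k', k = k' + 1 := ⟨k - 1, by omega⟩
    have hZ : Measurable[history X (k + 1)] (runState X (selectionEventFrom D X m p) m p k) :=
      (measurable_runState fun j hj hjk => ih j (by omega) hj (by omega)).mono
        (history_mono X k.le_succ) le_rfl
    have := (hZ.prodMk (measurable_history k.succ_pos)) (measurableSet_acceptance
      (hD.measurable (k + 1) (Finset.mem_Icc.2 ⟨by omega, hkn⟩)))
    convert this using 1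
    ext ω
    change X (k + 1) ω ∈ D (k + 1) (stateFrom D (fun j => X j ω) m p k).1
      (stateFrom D (fun j => X j ω) m p k).2 ↔ _
    rw [stateFrom_eq_runState]
    rfl

theorem mem_selectionEventFrom_succ {D : ℕ → unitInterval → Bool → Set unitInterval} {k : ℕ}
    {ω : Ω} : ω ∈ selectionEventFrom D X m p (k + 1) ↔
      X (k + 1) ω ∈ D (k + 1) (runState X (selectionEventFrom D X m p) m p k ω).1
        (runState X (selectionEventFrom D X m p) m p k ω).2 := by
  rw [← stateFrom_eq_runState]
  rfl

theorem IsMarkovPolicy.isAdmissible {D : ℕ → unitInterval → Bool → Set unitInterval}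
    (hD : IsMarkovPolicy n D) : IsAdmissible X n m p (selectionEventFrom D X m p) := by
  intro k _ hkn ω hω hR
  have h := mem_selectionEventFrom_succ.1 hω
  rw [hR] at h
  exact hD.admissible (k + 1) (Finset.mem_Icc.2 ⟨by omega, hkn⟩) _ h

variable [MeasurableSpace Ω] {P : Measure Ω}

theorem history_le (hX : ∀ i ∈ Finset.Icc 1 n, Measurable (X i)) {k : ℕ} (hk : k ≤ n) :
    history X k ≤ ‹MeasurableSpace Ω› :=
  iSup₂_le fun j hj => (hX j (Finset.Icc_subset_Icc_right hk hj)).comap_le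

theorem indep_history (hX : ∀ i ∈ Finset.Icc 1 n, Measurable (X i))
    (hindep : iIndepFun (fun i : Finset.Icc 1 n => X i) P) {k : ℕ} (hk : k + 1 ≤ n) :
    Indep (history X k) (MeasurableSpace.comap (X (k + 1)) inferInstance) P := by
  have hdisj : Disjoint {i : Finset.Icc 1 n | (i : ℕ) ≤ k} {i : Finset.Icc 1 n | (i : ℕ) = k + 1} :=
    Set.disjoint_left.2 fun i (hi : (i : ℕ) ≤ k) (hi' : (i : ℕ) = k + 1) => by omega
  have h := indep_iSup_of_disjoint (fun i : Finset.Icc 1 n => (hX i i.2).comap_le) hindep hdisj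
  refine indep_of_indep_of_le_left (indep_of_indep_of_le_right h ?_) ?_
  · exact le_iSup₂_of_le (f := fun (i : Finset.Icc 1 n) (_ : i ∈ {i : Finset.Icc 1 n |
      (i : ℕ) = k + 1}) => MeasurableSpace.comap (X i) inferInstance)
      ⟨k + 1, Finset.mem_Icc.2 ⟨by omega, hk⟩⟩ rfl le_rfl
  · refine iSup₂_le fun j hj => ?_
    have hj' := Finset.mem_Icc.1 hj
    exact le_iSup₂_of_le (f := fun (i : Finset.Icc 1 n) (_ : i ∈ {i : Finset.Icc 1 n |
      (i : ℕ) ≤ k}) => MeasurableSpace.comap (X i) inferInstance)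
      ⟨j, Finset.mem_Icc.2 ⟨hj'.1, by omega⟩⟩ hj'.2 le_rfl

/-- The next observation is uniform and independent of the current state. -/
theorem map_prodMk_eq [IsProbabilityMeasure P] (hX : ∀ i ∈ Finset.Icc 1 n, Measurable (X i))
    (hunif : ∀ i ∈ Finset.Icc 1 n, P.map (X i) = volume)
    (hindep : iIndepFun (fun i : Finset.Icc 1 n => X i) P) {k : ℕ} (hk : k + 1 ≤ n)
    {Z : Ω → unitInterval × Bool} (hZ : Measurable[history X k] Z) :
    P.map (fun ω => (Z ω, X (k + 1) ω)) = (P.map Z).prod volume := by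
  have hk' : k + 1 ∈ Finset.Icc 1 n := Finset.mem_Icc.2 ⟨by omega, hk⟩
  have hZ' : Measurable Z := hZ.mono (history_le hX (by omega)) le_rfl
  have hind : IndepFun Z (X (k + 1)) P :=
    (IndepFun_iff_Indep _ _ _).2
      (indep_of_indep_of_le_left (indep_history hX hindep hk) hZ.comap_le)
  rw [(indepFun_iff_map_prod_eq_prod_map_map hZ'.aemeasurable (hX _ hk').aemeasurable).1 hind,
    hunif _ hk']

theorem expectedLength_eq_sum [IsFiniteMeasure P]
    (hA : ∀ k, m ≤ k → k ≤ n → MeasurableSet (A k)) (hm : 1 ≤ m) :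
    expectedLength P m n A = ∑ k ∈ Finset.Ico (m - 1) n, P.real (A (k + 1)) := by
  classical
  have hcard : ∀ ω, ((selectedIndices A m n ω).ncard : ℝ) =
      ∑ k ∈ Finset.Ico (m - 1) n, (A (k + 1)).indicator (fun _ => (1 : ℝ)) ω := by
    intro ω
    have hset : selectedIndices A m n ω =
        ((Finset.Ico (m - 1 + 1) (n + 1)).filter fun k => ω ∈ A k : Finset ℕ) := by
      ext k
      change (k ∈ Finset.Icc m n ∧ ω ∈ A k) ↔ _
      simp only [Finset.coe_filter, Set.mem_ofPred_eq, Finset.mem_Icc, Finset.mem_Ico]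
      refine and_congr_left fun _ => ?_
      omega
    rw [hset, Set.ncard_coe_finset, Finset.card_filter, Nat.cast_sum,
      ← Finset.sum_Ico_add' (fun k => ((if ω ∈ A k then 1 else 0 : ℕ) : ℝ))]
    refine Finset.sum_congr rfl fun k _ => ?_
    simp [Set.indicator_apply]
  have hmeas : ∀ k ∈ Finset.Ico (m - 1) n, MeasurableSet (A (k + 1)) := fun k hk => by
    have := Finset.mem_Ico.1 hk
    exact hA _ (by omega) (by omega)
  unfold expectedLength
  simp_rw [hcard]
  rw [integral_finsetSum _ fun k hk => (integrable_const _).indicator (hmeas k hk)]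
  refine Finset.sum_congr rfl fun k hk => ?_
  simp [integral_indicator (hmeas k hk)]

/-! ### The optimality equation along a policy -/

/-- The expected loss, relative to the better decision, in the decision about the observation
`k + 1`, if all later decisions are optimal. -/
noncomputable def expectedLoss (P : Measure Ω) (X : ℕ → Ω → unitInterval) (n m : ℕ)
    (p : unitInterval × Bool) (A : ℕ → Set Ω) (k : ℕ) : ℝ :=
  ∫ ω, bestReward (value (n - (k + 1))) (runState X A m p k ω) (X (k + 1) ω) -
    reward (value (n - (k + 1))) (runState X A m p k ω) (X (k + 1) ω) (ω ∈ A (k + 1)) ∂P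

section Loss

variable [IsProbabilityMeasure P] (hX : ∀ i ∈ Finset.Icc 1 n, Measurable (X i))
  (hunif : ∀ i ∈ Finset.Icc 1 n, P.map (X i) = volume)
  (hindep : iIndepFun (fun i : Finset.Icc 1 n => X i) P) (hm : 1 ≤ m)
  (hA : ∀ k, m ≤ k → k ≤ n → MeasurableSet[history X k] (A k))

include hX hA

theorem integrable_value_runState (j : ℕ) {k : ℕ} (hk : k ≤ n) :
    Integrable (fun ω => value j (runState X A m p k ω)) P :=
  Integrable.of_bound ((measurable_value j).comp ((measurable_runState
    fun i hi hik => hA i hi (hik.trans hk)).mono (history_le hX hk) le_rfl)).aestronglyMeasurable j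
    (Filter.Eventually.of_forall fun _ => abs_value_le j _)

theorem integrable_bestReward_runState (j : ℕ) {k : ℕ} (hk : k + 1 ≤ n) :
    Integrable (fun ω => bestReward (value j) (runState X A m p k ω) (X (k + 1) ω)) P :=
  Integrable.of_bound ((measurable_bestReward (measurable_value j)).comp
    (((measurable_runState fun i hi hik => hA i hi (by omega)).mono
      (history_le hX (by omega)) le_rfl).prodMk
        (hX _ (Finset.mem_Icc.2 ⟨k.succ_pos, hk⟩)))).aestronglyMeasurable (j + 1)
    (Filter.Eventually.of_forall fun _ => abs_bestReward_le (abs_value_le j) _ _)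

theorem integrable_reward_runState (j : ℕ) {k : ℕ} (hmk : m ≤ k + 1) (hk : k + 1 ≤ n) :
    Integrable (fun ω => reward (value j) (runState X A m p k ω) (X (k + 1) ω)
      (ω ∈ A (k + 1))) P :=
  Integrable.of_bound (measurable_reward (measurable_value j)
    ((measurable_runState fun i hi hik => hA i hi (by omega)).mono
      (history_le hX (by omega)) le_rfl)
    (hX _ (Finset.mem_Icc.2 ⟨k.succ_pos, hk⟩))
    (history_le hX hk _ (hA _ hmk hk))).aestronglyMeasurable (j + 1)
    (Filter.Eventually.of_forall fun _ => abs_reward_le (abs_value_le j) _ _ _)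

include hunif hindep

theorem integral_bestReward_runState (j : ℕ) {k : ℕ} (hk : k + 1 ≤ n) :
    ∫ ω, bestReward (value j) (runState X A m p k ω) (X (k + 1) ω) ∂P =
      ∫ ω, value (j + 1) (runState X A m p k ω) ∂P := by
  have hZ : Measurable[history X k] (runState X A m p k) :=
    measurable_runState fun i hi hik => hA i hi (by omega)
  have hZ' : Measurable (runState X A m p k) := hZ.mono (history_le hX (by omega)) le_rfl
  have hX' := hX _ (Finset.mem_Icc.2 ⟨k.succ_pos, hk⟩)
  have hb := measurable_bestReward (measurable_value j)
  have hmap := map_prodMk_eq hX hunif hindep hk hZ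
  have hprob : IsProbabilityMeasure (P.map (runState X A m p k)) :=
    Measure.isProbabilityMeasure_map hZ'.aemeasurable
  calc ∫ ω, bestReward (value j) (runState X A m p k ω) (X (k + 1) ω) ∂P
      = ∫ q, bestReward (value j) q.1 q.2 ∂(P.map fun ω => (runState X A m p k ω, X (k + 1) ω)) :=
        (integral_map (hZ'.prodMk hX').aemeasurable hb.aestronglyMeasurable).symm
    _ = ∫ q, (∫ x, bestReward (value j) q x) ∂(P.map (runState X A m p k)) := by
        rw [hmap]
        exact integral_prod _ (Integrable.of_bound hb.aestronglyMeasurable (j + 1)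
          (Filter.Eventually.of_forall fun _ => abs_bestReward_le (abs_value_le j) _ _))
    _ = ∫ q, value (j + 1) q ∂(P.map (runState X A m p k)) := rfl
    _ = _ := integral_map hZ'.aemeasurable (measurable_value _).aestronglyMeasurable

theorem integral_value_runState {k : ℕ} (hmk : m ≤ k + 1) (hk : k + 1 ≤ n) :
    ∫ ω, value (n - k) (runState X A m p k ω) ∂P =
      (P.real (A (k + 1)) + expectedLoss P X n m p A k) +
        ∫ ω, value (n - (k + 1)) (runState X A m p (k + 1) ω) ∂P := by
  have hAk : MeasurableSet (A (k + 1)) := history_le hX hk _ (hA _ hmk hk)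
  have hr : ∀ ω, reward (value (n - (k + 1))) (runState X A m p k ω) (X (k + 1) ω)
      (ω ∈ A (k + 1)) = (A (k + 1)).indicator (fun _ => (1 : ℝ)) ω +
        value (n - (k + 1)) (runState X A m p (k + 1) ω) := by
    intro ω
    unfold reward
    by_cases hω : ω ∈ A (k + 1)
    · rw [if_pos hω, Set.indicator_of_mem hω, runState_succ_of_mem hmk hω]
    · rw [if_neg hω, Set.indicator_of_notMem hω, runState_succ_of_notMem hω, zero_add]
  have hint := integral_add ((integrable_const (μ := P) (1 : ℝ)).indicator hAk)
    (integrable_value_runState (p := p) hX hA (n - (k + 1)) hk)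
  simp_rw [← hr] at hint
  rw [integral_indicator hAk] at hint
  rw [expectedLoss, integral_sub (integrable_bestReward_runState hX hA _ hk)
    (integrable_reward_runState hX hA _ hmk hk), hint,
    integral_bestReward_runState hX hunif hindep hA _ hk, show n - k = n - (k + 1) + 1 by omega,
    setIntegral_const]
  simp only [smul_eq_mul, mul_one]
  ring

include hm

/-- What an adapted policy misses of the value of the starting state is the sum of the expected
losses in its decisions. -/
theorem expectedLength_add_sum_expectedLoss (hmn : m ≤ n) :
    expectedLength P m n A + ∑ k ∈ Finset.Ico (m - 1) n, expectedLoss P X n m p A k =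
      value (n - (m - 1)) p := by
  have key : ∀ l, m - 1 ≤ l → l ≤ n →
      ∑ k ∈ Finset.Ico (m - 1) l, (P.real (A (k + 1)) + expectedLoss P X n m p A k) +
        ∫ ω, value (n - l) (runState X A m p l ω) ∂P = value (n - (m - 1)) p := by
    intro l hl
    induction l, hl using Nat.le_induction with
    | base =>
      intro _
      simp [runState_of_lt (show m - 1 < m by omega)]
    | succ l hl ih =>
      intro hln
      rw [Finset.sum_Ico_succ_top hl, add_assoc,
        ← integral_value_runState hX hunif hindep hA (by omega) hln]
      exact ih (by omega)
  rw [expectedLength_eq_sum (fun k hk hkn => history_le hX hkn _ (hA k hk hkn)) hm,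
    ← Finset.sum_add_distrib, ← key n (by omega) le_rfl]
  simp [value]

end Loss

/-! ### Optimal policies -/

theorem expectedLoss_nonneg (hA : IsAdmissible X n m p A) {k : ℕ} (hmk : m ≤ k + 1)
    (hk : k + 1 ≤ n) : 0 ≤ expectedLoss P X n m p A k :=
  integral_nonneg fun ω => sub_nonneg.2 (reward_le_bestReward (hA k hmk hk ω))

/-- The policy that selects whatever is worth selecting, according to the value function. -/
def greedyPolicy (n i : ℕ) (s : unitInterval) (r : Bool) : Set unitInterval :=
  greedySet (value (n - i)) (s, r)

theorem isMarkovPolicy_greedyPolicy (n : ℕ) : IsMarkovPolicy n (greedyPolicy n) where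
  measurable i _ r := by
    have hv := measurable_value (n - i)
    have hs : Measurable fun q : unitInterval × unitInterval => ((q.1, r), q.2) :=
      (measurable_fst.prodMk measurable_const).prodMk measurable_snd
    exact (hs measurableSet_admissible).inter (measurableSet_le
      (hv.comp (measurable_fst.comp hs))
      (measurable_const.add (hv.comp (measurable_nextState.comp hs))))
  admissible _ _ _ _ hx := hx.1 rfl

theorem expectedLoss_greedyPolicy (k : ℕ) :
    expectedLoss P X n m p (selectionEventFrom (greedyPolicy n) X m p) k = 0 := by
  unfold expectedLoss
  rw [← integral_zero Ω ℝ]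
  congr 1
  ext ω
  rw [propext mem_selectionEventFrom_succ]
  exact sub_eq_zero.2 (reward_greedySet _ _).symm

/-- A policy that is optimal from the state `p` on loses nothing in any of its decisions. -/
theorem IsOptimalFrom.expectedLoss_eq_zero [IsProbabilityMeasure P]
    (hX : ∀ i ∈ Finset.Icc 1 n, Measurable (X i))
    (hunif : ∀ i ∈ Finset.Icc 1 n, P.map (X i) = volume)
    (hindep : iIndepFun (fun i : Finset.Icc 1 n => X i) P) (hm : 1 ≤ m)
    {s : unitInterval} {r : Bool} (hA : IsOptimalFrom P X n m s r A) {k : ℕ} (hmk : m ≤ k + 1)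
    (hk : k + 1 ≤ n) : expectedLoss P X n m (s, r) A k = 0 := by
  have hG := isMarkovPolicy_greedyPolicy n
  have hAadm := hA.1.isAdmissible hm
  have hGopt := hA.2 _ (hG.isAdmissible.isFeasibleFrom (X := X) (s := s) (r := r) hm (by omega)
    fun k hk => hG.adapted hm k (Finset.mem_Icc.1 hk).1 (Finset.mem_Icc.1 hk).2)
  have h1 := expectedLength_add_sum_expectedLoss (p := (s, r)) hX hunif hindep hm
    (fun k hk hkn => hG.adapted (p := (s, r)) hm k hk hkn) (by omega)
  have h2 := expectedLength_add_sum_expectedLoss (p := (s, r)) hX hunif hindep hm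
    (fun k hk hkn => hA.1.adapted k (Finset.mem_Icc.2 ⟨hk, hkn⟩)) (by omega)
  rw [Finset.sum_eq_zero fun k _ => expectedLoss_greedyPolicy k] at h1
  have hnn : ∀ l ∈ Finset.Ico (m - 1) n, 0 ≤ expectedLoss P X n m (s, r) A l := fun l hl => by
    have := Finset.mem_Ico.1 hl
    exact expectedLoss_nonneg hAadm (by omega) (by omega)
  have hsum : ∑ l ∈ Finset.Ico (m - 1) n, expectedLoss P X n m (s, r) A l = 0 :=
    le_antisymm (by linarith) (Finset.sum_nonneg hnn)
  exact (Finset.sum_eq_zero_iff_of_nonneg hnn).1 hsum k (Finset.mem_Ico.2 ⟨by omega, by omega⟩)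

/-- The acceptance sets of an optimal Markov policy are almost surely intervals. -/
theorem IsMarkovPolicy.ae_eq_Icc [IsProbabilityMeasure P]
    (hX : ∀ i ∈ Finset.Icc 1 n, Measurable (X i))
    (hunif : ∀ i ∈ Finset.Icc 1 n, P.map (X i) = volume)
    (hindep : iIndepFun (fun i : Finset.Icc 1 n => X i) P) (hm : 1 ≤ m)
    {D : ℕ → unitInterval → Bool → Set unitInterval} (hD : IsMarkovPolicy n D)
    {s : unitInterval} {r : Bool}
    (hopt : IsOptimalFrom P X n m s r (selectionEventFrom D X m (s, r))) {k : ℕ}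
    (hmk : m ≤ k + 1) (hk : k + 1 ≤ n) :
    ∀ᵐ q ∂(P.map (runState X (selectionEventFrom D X m (s, r)) m (s, r) k)),
      D (k + 1) q.1 q.2 =ᵐ[volume] Set.Icc (greedyLeft (value (n - (k + 1))) q.1 q.2)
        (greedyRight (value (n - (k + 1))) q.1 q.2) := by
  set A := selectionEventFrom D X m (s, r)
  set v := value (n - (k + 1))
  have hv : Measurable v := measurable_value _
  have hA : ∀ k, m ≤ k → k ≤ n → MeasurableSet[history X k] (A k) := hD.adapted hm
  have hk' : k + 1 ∈ Finset.Icc 1 n := Finset.mem_Icc.2 ⟨by omega, hk⟩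
  have hZ : Measurable[history X k] (runState X A m (s, r) k) :=
    measurable_runState fun i hi hik => hA i hi (by omega)
  have hZ' : Measurable (runState X A m (s, r) k) := hZ.mono (history_le hX (by omega)) le_rfl
  have hDm := measurableSet_acceptance (hD.measurable (k + 1) hk')
  have hloss := hopt.expectedLoss_eq_zero hX hunif hindep hm hmk hk
  have hadm : IsAdmissible X n m (s, r) A := hD.isAdmissible
  -- No loss in expectation means no loss at almost every state and observation.
  have h1 : ∀ᵐ ω ∂P, reward v (runState X A m (s, r) k ω) (X (k + 1) ω)
      ((runState X A m (s, r) k ω, X (k + 1) ω) ∈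
        {q : (unitInterval × Bool) × unitInterval | q.2 ∈ D (k + 1) q.1.1 q.1.2}) =
      bestReward v (runState X A m (s, r) k ω) (X (k + 1) ω) := by
    have h0 := (integral_eq_zero_iff_of_nonneg
      (fun ω => sub_nonneg.2 (reward_le_bestReward (v := v) (hadm k hmk hk ω)))
      ((integrable_bestReward_runState hX hA _ hk).sub
        (integrable_reward_runState hX hA _ hmk hk))).1 hloss
    filter_upwards [h0] with ω hω
    have hω' := (sub_eq_zero.1 hω).symm
    rwa [propext (mem_selectionEventFrom_succ (D := D) (p := (s, r)))] at hω'
  have hset : MeasurableSet {q : (unitInterval × Bool) × unitInterval |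
      reward v q.1 q.2 (q ∈ {q : (unitInterval × Bool) × unitInterval |
        q.2 ∈ D (k + 1) q.1.1 q.1.2}) = bestReward v q.1 q.2} :=
    measurableSet_eq_fun (measurable_reward hv measurable_fst measurable_snd hDm)
      (measurable_bestReward hv)
  have h2 := (ae_map_iff (hZ'.prodMk (hX _ hk')).aemeasurable hset).2 h1
  rw [map_prodMk_eq hX hunif hindep hk hZ] at h2
  filter_upwards [Measure.ae_ae_of_ae_prod h2] with q hq
  refine Filter.EventuallyEq.trans ?_
    ((isRegularValue_value (n - (k + 1))).greedySet_ae_eq q.1 q.2)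
  filter_upwards [hq, ae_value_ne (n - (k + 1)) q] with x hx hne
  refine propext (mem_greedySet_iff_of_reward_eq (c := x ∈ D (k + 1) q.1 q.2) ?_ hx hne)
  intro hxD hR
  rw [hR] at hxD
  exact hD.admissible (k + 1) hk' _ hxD

end Probability

end UnimodalSelection

open UnimodalSelection in
theorem mainTheorem4 {Ω : Type*} [MeasurableSpace Ω] (P : Measure Ω) [IsProbabilityMeasure P]
    (n : ℕ) (X : ℕ → Ω → unitInterval)
    (hX : ∀ i ∈ Finset.Icc 1 n, Measurable (X i))
    (hunif : ∀ i ∈ Finset.Icc 1 n, P.map (X i) = volume)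
    (hindep : iIndepFun (fun i : Finset.Icc 1 n => X i) P)
    (D : ℕ → unitInterval → Bool → Set unitInterval)
    (hD : UnimodalSelection.IsMarkovPolicy n D)
    (hopt : UnimodalSelection.IsOptimal P X n (UnimodalSelection.selectionEvent D X)) :
    ∃ a b : ℕ → unitInterval → Bool → unitInterval,
      UnimodalSelection.IsIntervalPolicy n a b ∧
      (∀ i ∈ Finset.Icc 1 n, ∀ᵐ ω ∂P,
        D i (UnimodalSelection.state D (fun j => X j ω) (i - 1)).1
            (UnimodalSelection.state D (fun j => X j ω) (i - 1)).2 =ᵐ[volume]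
          Set.Icc
            (a i (UnimodalSelection.state D (fun j => X j ω) (i - 1)).1
              (UnimodalSelection.state D (fun j => X j ω) (i - 1)).2)
            (b i (UnimodalSelection.state D (fun j => X j ω) (i - 1)).1
              (UnimodalSelection.state D (fun j => X j ω) (i - 1)).2)) ∧
      (∀ᵐ ω ∂P, ∀ i ∈ Finset.Icc 1 n,
        (ω ∈ UnimodalSelection.selectionEvent D X i ↔
          ω ∈ UnimodalSelection.selectionEvent (UnimodalSelection.intervalRule a b) X i)) ∧
      (∀ i ∈ Finset.Icc 1 n, ∀ (s : unitInterval) (r : Bool),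
        UnimodalSelection.IsOptimalFrom P X n i s r
          (UnimodalSelection.selectionEventFrom D X i (s, r)) →
        D i s r =ᵐ[volume] Set.Icc (a i s r) (b i s r)) := by
  set a : ℕ → unitInterval → Bool → unitInterval := fun i => greedyLeft (value (n - i))
  set b : ℕ → unitInterval → Bool → unitInterval := fun i => greedyRight (value (n - i))
  have hinterval : IsIntervalPolicy n a b :=
    { left_le := fun _ _ _ _ => min_le_left _ _
      le_right := fun _ _ _ => le_max_left _ _
      right_eq := fun _ _ _ => rfl
      measurable_left := fun _ _ => (isRegularValue_value _).measurable_greedyLeft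
      measurable_right := fun _ _ => (isRegularValue_value _).measurable_greedyRight }
  have hopt' : IsOptimalFrom P X n 1 0 false (selectionEventFrom D X 1 (0, false)) :=
    ⟨isFeasible_iff_isFeasibleFrom.1 hopt.1,
      fun B hB => hopt.2 B (isFeasible_iff_isFeasibleFrom.2 hB)⟩
  have hA : ∀ k, 1 ≤ k → k ≤ n →
      MeasurableSet[history X k] (selectionEventFrom D X 1 (0, false) k) := hD.adapted le_rfl
  have hZ : ∀ k, k ≤ n → Measurable[history X k]
      (runState X (selectionEventFrom D X 1 (0, false)) 1 (0, false) k) := fun k hk =>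
    measurable_runState fun i hi hik => hA i hi (by omega)
  have hZ' : ∀ k, k ≤ n → Measurable
      (runState X (selectionEventFrom D X 1 (0, false)) 1 (0, false) k) := fun k hk =>
    (hZ k hk).mono (history_le hX hk) le_rfl
  have hstate : ∀ k ω, state D (fun j => X j ω) k =
      runState X (selectionEventFrom D X 1 (0, false)) 1 (0, false) k ω := fun k ω =>
    stateFrom_eq_runState D k ω
  refine ⟨a, b, hinterval, fun i hi => ?_, ?_, fun i hi s r hi_opt => ?_⟩
  · obtain ⟨k, rfl⟩ : ∃ k, i = k + 1 := ⟨i - 1, by have := (Finset.mem_Icc.1 hi).1; omega⟩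
    have hk := (Finset.mem_Icc.1 hi).2
    have := ae_of_ae_map (hZ' k (by omega)).aemeasurable
      (hD.ae_eq_Icc hX hunif hindep le_rfl hopt' (by omega) hk)
    filter_upwards [this] with ω hω
    rw [Nat.add_sub_cancel, hstate]
    exact hω
  · have hsel : ∀ᵐ ω ∂P, ∀ k, k + 1 ≤ n → (X (k + 1) ω ∈ D (k + 1)
        (state D (fun j => X j ω) k).1 (state D (fun j => X j ω) k).2 ↔
        X (k + 1) ω ∈ intervalRule a b (k + 1) (state D (fun j => X j ω) k).1
          (state D (fun j => X j ω) k).2) := by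
      refine ae_all_iff.2 fun k => ?_
      by_cases hk : k + 1 ≤ n
      swap
      · exact Filter.Eventually.of_forall fun _ h => absurd h hk
      have hk' : k + 1 ∈ Finset.Icc 1 n := Finset.mem_Icc.2 ⟨by omega, hk⟩
      have h1 := measurableSet_acceptance (hD.measurable (k + 1) hk')
      have h2 : MeasurableSet {q : (unitInterval × Bool) × unitInterval |
          q.2 ∈ intervalRule a b (k + 1) q.1.1 q.1.2} :=
        measurableSet_acceptance (E := intervalRule a b (k + 1)) fun r =>
          (measurableSet_le (α := unitInterval)
            ((hinterval.measurable_left _ hk' r).comp measurable_fst) measurable_snd).inter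
          (measurableSet_le (α := unitInterval) measurable_snd
            ((hinterval.measurable_right _ hk' r).comp measurable_fst))
      have h3 : MeasurableSet {q : (unitInterval × Bool) × unitInterval |
          q.2 ∈ D (k + 1) q.1.1 q.1.2 ↔ q.2 ∈ intervalRule a b (k + 1) q.1.1 q.1.2} := h1.iff h2
      have h4 : ∀ᵐ q ∂(P.map (runState X (selectionEventFrom D X 1 (0, false)) 1
          (0, false) k)).prod (volume : Measure unitInterval),
          q.2 ∈ D (k + 1) q.1.1 q.1.2 ↔ q.2 ∈ intervalRule a b (k + 1) q.1.1 q.1.2 := by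
        refine (Measure.ae_prod_iff_ae_ae h3).2 ?_
        filter_upwards [hD.ae_eq_Icc hX hunif hindep le_rfl hopt' (by omega) hk] with q hq
        filter_upwards [hq] with x hx
        exact Iff.of_eq hx
      rw [← map_prodMk_eq hX hunif hindep hk (hZ k (by omega))] at h4
      have h5 := ae_of_ae_map ((hZ' k (by omega)).prodMk (hX _ hk')).aemeasurable h4
      filter_upwards [h5] with ω hω _
      rw [hstate]
      exact hω
    filter_upwards [hsel] with ω hω
    -- The two policies pass through the same states, by induction on the time.
    have hstates : ∀ k, k ≤ n →
        state (intervalRule a b) (fun j => X j ω) k = state D (fun j => X j ω) k := by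
      intro k
      induction k with
      | zero => exact fun _ => rfl
      | succ k ih =>
        intro hk
        have hs : ∀ E : ℕ → unitInterval → Bool → Set unitInterval,
            state E (fun j => X j ω) (k + 1) =
              step (E (k + 1)) (X (k + 1) ω) (state E (fun j => X j ω) k) := fun E => by
          unfold state
          rw [stateFrom, if_neg (by omega)]
        rw [hs, hs, ih (by omega)]
        unfold step
        rw [propext (hω k hk)]
    intro i hi
    obtain ⟨k, rfl⟩ : ∃ k, i = k + 1 := ⟨i - 1, by have := (Finset.mem_Icc.1 hi).1; omega⟩
    have hk := (Finset.mem_Icc.1 hi).2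
    change X (k + 1) ω ∈ D (k + 1) (state D (fun j => X j ω) k).1
      (state D (fun j => X j ω) k).2 ↔ X (k + 1) ω ∈ intervalRule a b (k + 1)
        (state (intervalRule a b) (fun j => X j ω) k).1
        (state (intervalRule a b) (fun j => X j ω) k).2
    rw [hstates k (by omega)]
    exact hω k hk
  · -- The state just before the `i`-th observation is the starting state.
    obtain ⟨k, rfl⟩ : ∃ k, i = k + 1 := ⟨i - 1, by have := (Finset.mem_Icc.1 hi).1; omega⟩
    have h := hD.ae_eq_Icc hX hunif hindep (by omega) hi_opt le_rfl (Finset.mem_Icc.1 hi).2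
    have hc : runState X (selectionEventFrom D X (k + 1) (s, r)) (k + 1) (s, r) k =
        fun _ => (s, r) := funext (runState_of_lt k.lt_succ_self)
    rw [hc] at h
    exact (ae_of_ae_map measurable_const.aemeasurable h).exists.choose_spec
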